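/- Let $A$ be a finite alphabet, $L\subseteq A^*$ a regular language, $M$ its syntactic ordered monoid, i.e. the quotient of $A^*$ by the equivalence of the syntactic preorder ($w\le_L w'$ iff for all $x,y\in A^*$, $xwy\in L$ implies $xw'y\in L$), with the order induced by $\le_L$, and let $\alpha:A^*\to M$ be the syntactic morphism. Let $\omega\ge 1$ be such that $s^\omega$ is idempotent for every $s\in M$. For $i\ge 0$, a first-order formula over words (with the order $<$ on positions and a letter predicate $P_a$ for each $a\in A$) is $\Sigma_i(<)$ if its quantifiers can be moved to the front so as to form at most $i$ blocks, the first of which is existential if there are $i$ of them. For $k\ge 0$ write $w\lesssim_i^k w'$ if every $\Sigma_i(<)$ sentence of quantifier rank at most $k$ satisfied by $w$ is satisfied by $w'$. For $i\ge 1$, a pair $(t,s)\in M^2$ is a $\Sigma_i$-chain of length $2$ for $\alpha$ if for every $k$ there are words $w_1,w_2\in A^*$ with $w_1\lesssim_i^k w_2$, $\alpha(w_1)=t$ and $\alpha(w_2)=s$; for $i=0$, every pair $(t,s)\in M^2$ is a $\Sigma_0$-chain. Then for every $i\ge 1$, $L$ is definable by a $\Sigma_i(<)$ sentence if and only if $$s^\omega\le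 s^\omega t s^\omega\quad\text{for every $\Sigma_{i-1}$-chain $(t,s)$ of length $2$ for $\alpha$.}$$ -/

import Mathlib

namespace QAlt

universe u v

/-! ### First-order logic over finite words -/

/-- The relation symbols of `FO(<)` over the alphabet `A`: the binary symbol `<`, and a unary
symbol `P_a` for every letter `a`. -/
inductive WordRel (A : Type u) : ℕ → Type u
  | lt : WordRel A 2
  | letter (a : A) : WordRel A 1

/-- The relational first-order signature of words over `A`. -/
def wordLang (A : Type u) : FirstOrder.Language.{0, u} :=
  ⟨fun _ => Empty, WordRel A⟩

/-- A word `w`, viewed as a logical structure: the domain is the set of positions of `w`, `<` is the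
order of positions and `P_a` selects the positions labeled by `a`. The domain of the empty word is
empty. -/
@[reducible] def wordStructure {A : Type u} (w : List A) : (wordLang A).Structure (Fin w.length) where
  funMap := fun f _ => f.elim
  RelMap := fun {_} R =>
    match R with
    | WordRel.lt => fun x => x 0 < x 1
    | WordRel.letter a => fun x => w.get (x 0) = a

/-- The word `w` satisfies the sentence `φ`. -/
def Models {A : Type u} (w : FreeMonoid A) (φ : (wordLang A).Sentence) : Prop :=
  @FirstOrder.Language.Sentence.Realize (wordLang A) (Fin w.toList.length)
    (wordStructure w.toList) φ

/-- Quantifier rank: the maximal number of nested quantifiers. -/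
def quantRank {A : Type u} : ∀ {n : ℕ}, (wordLang A).BoundedFormula Empty n → ℕ
  | _, .falsum => 0
  | _, .equal _ _ => 0
  | _, .rel _ _ => 0
  | _, .imp φ ψ => max (quantRank φ) (quantRank ψ)
  | _, .all φ => quantRank φ + 1

/-- The levels of the quantifier alternation hierarchy, on arbitrary (not necessarily prenex)
first-order formulas. `InLevel true i φ` means that `φ` is a `Σ_i` formula, `InLevel false i φ` that
it is a `Π_i` formula: moving the quantifiers of `φ` to the front by the usual prenexing rules can be
done so that one gets at most `i` blocks of quantifiers, the first of which (if there are `i` of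
them) is existential, respectively universal.

The primitive connective of formulas is implication, so `imp` covers all Boolean operations
(`¬ φ` is `φ → ⊥`, `φ ∧ ψ` is `¬ (φ → ¬ ψ)`, `φ ∨ ψ` is `¬ φ → ψ`); a quantifier in front of the
premise of an implication changes its type when it is moved out. -/
inductive InLevel {A : Type u} :
    Bool → ℕ → ∀ {n : ℕ}, (wordLang A).BoundedFormula Empty n → Prop
  | of_isQF {b : Bool} {i n : ℕ} {φ : (wordLang A).BoundedFormula Empty n} :
      φ.IsQF → InLevel b i φ
  | imp {b : Bool} {i n : ℕ} {φ ψ : (wordLang A).BoundedFormula Empty n} :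
      InLevel (!b) i φ → InLevel b i ψ → InLevel b i (φ.imp ψ)
  | ex {i n : ℕ} {φ : (wordLang A).BoundedFormula Empty (n + 1)} :
      InLevel true (i + 1) φ → InLevel true (i + 1) φ.ex
  | all {i n : ℕ} {φ : (wordLang A).BoundedFormula Empty (n + 1)} :
      InLevel false (i + 1) φ → InLevel false (i + 1) φ.all
  | next {b : Bool} {i n : ℕ} {φ : (wordLang A).BoundedFormula Empty n} :
      InLevel (!b) i φ → InLevel b (i + 1) φ

/-- `φ` is a `Σ_i(<)` sentence. -/
def IsSigma {A : Type u} (i : ℕ) (φ : (wordLang A).Sentence) : Prop :=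
  InLevel true i φ

/-- The language `L` is definable by a `Σ_i(<)` sentence. -/
def SigmaDefinable {A : Type u} (i : ℕ) (L : Language A) : Prop :=
  ∃ φ : (wordLang A).Sentence, IsSigma i φ ∧ ∀ w : FreeMonoid A, w.toList ∈ L ↔ Models w φ

/-- The preorder of `Σ_i` at rank `k`: every `Σ_i` sentence of quantifier rank at most `k` that
is satisfied by `w` is satisfied by `w'`. -/
def SigmaLE {A : Type u} (i k : ℕ) (w w' : FreeMonoid A) : Prop :=
  ∀ φ : (wordLang A).Sentence, IsSigma i φ → quantRank φ ≤ k → Models w φ → Models w' φ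

/-! ### Chains -/

/-- The set of `Σ_i[k]`-chains for the morphism `α`: the sequences `(s_1, …, s_n)` that are the
images of words `w_1, …, w_n`, each below the next one in the preorder of `Σ_i` at rank `k`. For
`i = 0`, all sequences, by convention. -/
def sigmaKChains {A : Type u} {M : Type v} [Monoid M] (α : FreeMonoid A →* M) (i k : ℕ) :
    Set (List M) :=
  match i with
  | 0 => Set.univ
  | j + 1 => {s | ∃ ws : List (FreeMonoid A), ws.IsChain (SigmaLE (j + 1) k) ∧ ws.map α = s}

/-- The set of `Σ_i`-chains for the morphism `α`. -/
def sigmaChains {A : Type u} {M : Type v} [Monoid M] (α : FreeMonoid A →* M) (i : ℕ) :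
    Set (List M) :=
  ⋂ k : ℕ, sigmaKChains α i k

/-! ### The syntactic ordered monoid -/

/-- The syntactic preorder of `L`. -/
def SyntacticLE {A : Type u} (L : Language A) (w w' : FreeMonoid A) : Prop :=
  ∀ x y : FreeMonoid A, (x * w * y).toList ∈ L → (x * w' * y).toList ∈ L

theorem SyntacticLE.mul {A : Type u} {L : Language A} {w w' z z' : FreeMonoid A}
    (h : SyntacticLE L w w') (h' : SyntacticLE L z z') : SyntacticLE L (w * z) (w' * z') := by
  intro x y hxy
  have h1 := h x (z * y) (by simpa only [mul_assoc] using hxy)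
  have h2 := h' (x * w') y (by simpa only [mul_assoc] using h1)
  simpa only [mul_assoc] using h2

/-- The syntactic equivalence of `L`, as a congruence of the free monoid. -/
def syntacticCon {A : Type u} (L : Language A) : Con (FreeMonoid A) where
  r w w' := SyntacticLE L w w' ∧ SyntacticLE L w' w
  iseqv :=
    { refl := fun _ => ⟨fun _ _ h => h, fun _ _ h => h⟩
      symm := fun h => ⟨h.2, h.1⟩
      trans := fun h h' =>
        ⟨fun x y hx => h'.1 x y (h.1 x y hx), fun x y hx => h.2 x y (h'.2 x y hx)⟩ }
  mul' := fun h h' => ⟨h.1.mul h'.1, h.2.mul h'.2⟩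

/-- The syntactic monoid of `L`. -/
def SyntacticMonoid {A : Type u} (L : Language A) : Type u :=
  (syntacticCon L).Quotient

instance {A : Type u} (L : Language A) : Monoid (SyntacticMonoid L) :=
  inferInstanceAs (Monoid (syntacticCon L).Quotient)

/-- The syntactic morphism of `L`. -/
def syntacticMorphism {A : Type u} (L : Language A) : FreeMonoid A →* SyntacticMonoid L :=
  (syntacticCon L).mk'

/-- The partial order of the syntactic monoid, induced by the syntactic preorder. -/
instance {A : Type u} (L : Language A) : PartialOrder (SyntacticMonoid L) where
  le s t := Quotient.liftOn₂ s t (SyntacticLE L) (fun _ _ _ _ h h' => propext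
    ⟨fun H x y hx => h'.1 x y (H x y (h.2 x y hx)),
      fun H x y hx => h'.2 x y (H x y (h.1 x y hx))⟩)
  le_refl s := Quotient.inductionOn s fun _ _ _ h => h
  le_trans s t r := Quotient.inductionOn₃ s t r fun _ _ _ h h' x y hx => h' x y (h x y hx)
  le_antisymm s t := Quotient.inductionOn₂ s t fun _ _ h h' => Quotient.sound ⟨h, h'⟩

theorem syntacticMorphism_le_iff {A : Type u} (L : Language A) (w w' : FreeMonoid A) :
    syntacticMorphism L w ≤ syntacticMorphism L w' ↔ SyntacticLE L w w' :=
  Iff.rfl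

theorem syntacticMorphism_surjective {A : Type u} (L : Language A) :
    Function.Surjective (syntacticMorphism L) :=
  Con.mk'_surjective

/-- The order of the syntactic monoid is compatible with multiplication. -/
theorem SyntacticMonoid.mul_le_mul {A : Type u} {L : Language A} {s t s' t' : SyntacticMonoid L}
    (h : s ≤ t) (h' : s' ≤ t') : s * s' ≤ t * t' := by
  obtain ⟨a, rfl⟩ := syntacticMorphism_surjective L s
  obtain ⟨b, rfl⟩ := syntacticMorphism_surjective L t
  obtain ⟨c, rfl⟩ := syntacticMorphism_surjective L s'
  obtain ⟨d, rfl⟩ := syntacticMorphism_surjective L t'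
  rw [← map_mul, ← map_mul]
  exact SyntacticLE.mul h h'

/-- The syntactic monoid of a regular language is finite. -/
theorem finite_syntacticMonoid {A : Type u} {L : Language A} (hL : L.IsRegular) :
    Finite (SyntacticMonoid L) := by
  obtain ⟨σ, _, D, rfl⟩ := hL
  let f : SyntacticMonoid D.accepts → (σ → σ) := fun s q =>
    D.evalFrom q (Function.surjInv (syntacticMorphism_surjective D.accepts) s).toList
  refine Finite.of_injective f fun s t hst => ?_
  have key : ∀ w w' : FreeMonoid A,
      (∀ q, D.evalFrom q w.toList = D.evalFrom q w'.toList) → SyntacticLE D.accepts w w' := by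
    intro w w' h x y hx
    simp only [FreeMonoid.toList_mul, DFA.mem_accepts, DFA.eval, DFA.evalFrom_of_append] at hx ⊢
    rwa [← h]
  rw [← Function.surjInv_eq (syntacticMorphism_surjective D.accepts) s,
    ← Function.surjInv_eq (syntacticMorphism_surjective D.accepts) t]
  exact le_antisymm (key _ _ fun q => congrFun hst q) (key _ _ fun q => (congrFun hst q).symm)

/-! ### Idempotent powers -/

/-- The number `ω` of a monoid `M`: the least positive integer such that `s ^ ω` is idempotent for
every `s`. It exists when `M` is finite. -/
noncomputable def omega (M : Type v) [Monoid M] : ℕ :=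
  sInf {n : ℕ | 0 < n ∧ ∀ s : M, IsIdempotentElem (s ^ n)}

theorem exists_omega (M : Type v) [Monoid M] [Finite M] :
    ∃ n : ℕ, 0 < n ∧ ∀ s : M, IsIdempotentElem (s ^ n) := by
  have h : ∀ s : M, ∃ n : ℕ, 0 < n ∧ IsIdempotentElem (s ^ n) := by
    intro s
    obtain ⟨a, b, hab, he⟩ := Finite.exists_ne_map_eq_of_infinite (fun n : ℕ => s ^ n)
    wlog hlt : a < b generalizing a b
    · exact this b a hab.symm he.symm (by omega)
    obtain ⟨p, rfl⟩ := Nat.exists_eq_add_of_lt hlt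
    have h1 : ∀ m c : ℕ, s ^ (a + m) = s ^ (a + m + c * (p + 1)) := by
      intro m c
      induction c with
      | zero => simp
      | succ c ih =>
        have e1 : a + m + c * (p + 1) = a + (m + c * (p + 1)) := by ring
        have e2 : a + m + (c + 1) * (p + 1) = (a + p + 1) + (m + c * (p + 1)) := by ring
        have he' : s ^ a = s ^ (a + p + 1) := he
        rw [ih, e1, e2, pow_add, he', ← pow_add]
    refine ⟨(a + 1) * (p + 1), by positivity, ?_⟩
    have e3 : (a + 1) * (p + 1) = a + (a * p + p + 1) := by ring
    unfold IsIdempotentElem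
    rw [← pow_add, e3, h1 (a * p + p + 1) (a + 1)]
    congr 1
    ring
  choose f hf using h
  have := Fintype.ofFinite M
  refine ⟨∏ s : M, f s, Finset.prod_pos fun s _ => (hf s).1, fun s => ?_⟩
  obtain ⟨c, hc⟩ := Finset.dvd_prod_of_mem f (Finset.mem_univ s)
  rw [hc, pow_mul]
  exact (hf s).2.pow c

/-- On a finite monoid, `ω` is positive and `s ^ ω` is idempotent for every `s`. -/
theorem omega_spec (M : Type v) [Monoid M] [Finite M] :
    0 < omega M ∧ ∀ s : M, IsIdempotentElem (s ^ omega M) :=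
  Nat.sInf_mem (exists_omega M)

end QAlt

/-!
Write `i = j + 1`, let `α` be the syntactic morphism, and compare words by the alternation game
`GameLE i k`: `k` rounds, each move splitting a word at a position. The game preorders and the
preorders of `Σ_i` refine each other up to a change of rank: formulas of rank at most `k` are
preserved by the game (`GameLE.sigmaLE`), and over a finite alphabet the game has finitely many
principal upper sets, all `Σ_i`-definable (`finite_range_gameUpper_and_factorDefinable`).

If `L` is `Σ_{j+1}`-definable and `t ≤ v` at level `j`, then `v ^ n ≤ v ^ n t v ^ n` at level `j + 1`
for large `n` (`GameLE.pow_pow_mul_pow`). Words with images `t` and `s` taken from the chain,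
and `n` a multiple of `ω`, give the inequality in the syntactic monoid.

Conversely, assume the inequality for all chains. It suffices that, at some fixed rank,
`w ≤ w'` in the game of level `j + 1` implies `α w ≤ α w'`, for then `L` is a finite union of
definable upper sets. This goes by induction on a factorization tree of `w` whose height is bounded
independently of `w` (`exists_forall_hasForest`). The main case is a node `w = u z v` whose three
factors have the same idempotent image `e`. The word `w'` splits accordingly as `u' z' v'`, and
`z ≤ z'` at level `j + 1` gives `z' ≤ z` at level `j`, so that `(α z', e)` is a chain and
`e ≤ e * α z' * e ≤ α u' * α z' * α v'` (`HasForest.le_of_gameLE`). No tree is needed for the middle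
factor, so a weak form of Simon's factorization forest theorem is enough. It is proved by
induction on the size of a submonoid containing the images of the factors, through
stabilizers of states.
-/

namespace QAlt

/-! ### Ramseyan factorizations of bounded height -/

section Forest

variable {A : Type*} {M : Type*} [Monoid M]

/-- `HasForest α h w`: the word `w` has a factorization tree of height at most `h` whose leaves are
letters or empty words and whose inner nodes are of two kinds: binary products, and products of
three factors with the same idempotent image. In the second case nothing is required of the middle
factor beyond its image, so this is weaker than Simon's factorization forests. -/
inductive HasForest (α : FreeMonoid A →* M) : ℕ → FreeMonoid A → Prop
  | one {h : ℕ} : HasForest α h 1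
  | of {h : ℕ} (a : A) : HasForest α h (FreeMonoid.of a)
  | mul {h : ℕ} {u v : FreeMonoid A} :
      HasForest α h u → HasForest α h v → HasForest α (h + 1) (u * v)
  | idem {h : ℕ} {u z v : FreeMonoid A} {e : M} : IsIdempotentElem e →
      HasForest α h u → HasForest α h v → α u = e → α z = e → α v = e →
      HasForest α (h + 1) (u * z * v)

theorem HasForest.mono {α : FreeMonoid A →* M} {h h' : ℕ} {w : FreeMonoid A}
    (hw : HasForest α h w) (hh : h ≤ h') : HasForest α h' w := by
  induction hh with
  | refl => exact hw
  | step _ ih => simpa using ih.mul HasForest.one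

/-- Products of words whose images lie in a set `Q` of pairwise left zeros (`q * q' = q`) have
forests of bounded height. A product of such words has the image of its first factor. With `q` the
image of the first word, cutting before the second and the last word of image `q` gives three
factors of image `q`; the remaining pieces avoid `q`, and the bound follows by induction on
`Q`. -/
theorem exists_hasForest_of_leftZero (α : FreeMonoid A →* M) (m h : ℕ) :
    ∃ h', ∀ Q : Finset M, Q.card ≤ m → (∀ q ∈ Q, ∀ q' ∈ Q, q * q' = q) →
      ∀ us : List (FreeMonoid A), (∀ u ∈ us, HasForest α h u ∧ α u ∈ Q) →
        HasForest α h' us.prod := by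
  classical
  induction m with
  | zero =>
    refine ⟨0, fun Q hQ _ us hus => ?_⟩
    cases us with
    | nil => exact HasForest.one
    | cons u us =>
      have := (hus u (by simp)).2
      simp_all
  | succ m ih =>
    obtain ⟨h₁, ih⟩ := ih
    refine ⟨max h h₁ + 4, fun Q hQ hmul us hus => ?_⟩
    have val : ∀ (u : FreeMonoid A) (l : List (FreeMonoid A)), α u ∈ Q →
        (∀ x ∈ l, α x ∈ Q) → α (u * l.prod) = α u := by
      intro u l hu hl
      induction l with
      | nil => simp
      | cons x l ihl =>
        rw [List.prod_cons, ← mul_assoc, map_mul, map_mul, hmul _ hu _ (hl x (by simp)),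
          ← map_mul]
        exact ihl fun y hy => hl y (by simp [hy])
    have avoid : ∀ (q : M) (l : List (FreeMonoid A)), q ∈ Q →
        (∀ x ∈ l, HasForest α h x ∧ α x ∈ Q ∧ α x ≠ q) →
        HasForest α (max h h₁) l.prod := by
      intro q l hq hl
      refine (ih (Q.erase q) ?_ ?_ l fun x hx => ?_).mono (le_max_right _ _)
      · rw [Finset.card_erase_of_mem hq]; omega
      · intro a ha b hb
        exact hmul a (Finset.mem_of_mem_erase ha) b (Finset.mem_of_mem_erase hb)
      · exact ⟨(hl x hx).1, Finset.mem_erase.2 ⟨(hl x hx).2.2, (hl x hx).2.1⟩⟩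
    have split : ∀ (q : M) (l : List (FreeMonoid A)),
        (∀ x ∈ l, α x ≠ q) ∨ ∃ l₁ x l₂, l = l₁ ++ x :: l₂ ∧ α x = q ∧ ∀ y ∈ l₁, α y ≠ q := by
      intro q l
      induction l with
      | nil => simp
      | cons x l ihl =>
        by_cases hx : α x = q
        · exact Or.inr ⟨[], x, l, rfl, hx, by simp⟩
        · rcases ihl with h' | ⟨l₁, y, l₂, rfl, hy, hl₁⟩
          · exact Or.inl (by simpa using ⟨hx, h'⟩)
          · exact Or.inr ⟨x :: l₁, y, l₂, rfl, hy, by simpa using ⟨hx, hl₁⟩⟩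
    have splitLast : ∀ (q : M) (l : List (FreeMonoid A)),
        (∀ x ∈ l, α x ≠ q) ∨ ∃ l₁ x l₂, l = l₁ ++ x :: l₂ ∧ α x = q ∧ ∀ y ∈ l₂, α y ≠ q := by
      intro q l
      rcases split q l.reverse with h' | ⟨l₁, x, l₂, hl, hx, hl₁⟩
      · exact Or.inl fun x hx => h' x (by simpa using hx)
      · refine Or.inr ⟨l₂.reverse, x, l₁.reverse, ?_, hx, fun y hy => hl₁ y (by simpa using hy)⟩
        rw [← List.reverse_reverse l, hl]; simp
    cases us with
    | nil => exact HasForest.one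
    | cons u l =>
      have hu := hus u (by simp)
      have hl : ∀ x ∈ l, HasForest α h x ∧ α x ∈ Q := fun x hx => hus x (by simp [hx])
      have hu' := hu.1.mono (le_max_left h h₁)
      rw [List.prod_cons]
      rcases split (α u) l with h' | ⟨x, v, y, rfl, hv, hx⟩
      · exact (hu'.mul (avoid _ l hu.2 fun x hx => ⟨(hl x hx).1, (hl x hx).2, h' x hx⟩)).mono
          (by omega)
      have hux := hu'.mul (avoid _ x hu.2 fun z hz =>
        ⟨(hl z (by simp [hz])).1, (hl z (by simp [hz])).2, hx z hz⟩)
      have hvf := ((hl v (by simp)).1.mono (le_max_left h h₁))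
      rcases splitLast (α u) y with h' | ⟨y₁, z, y₂, rfl, hz, hy₂⟩
      · have := hux.mul (hvf.mul (avoid _ y hu.2 fun z hz =>
          ⟨(hl z (by simp [hz])).1, (hl z (by simp [hz])).2, h' z hz⟩))
        simpa [mul_assoc] using this.mono (Nat.le_add_right _ 2)
      · have hzf := ((hl z (by simp)).1.mono (le_max_left h h₁))
        have hyf := avoid _ y₂ hu.2 fun z hz =>
          ⟨(hl z (by simp [hz])).1, (hl z (by simp [hz])).2, hy₂ z hz⟩
        have := (HasForest.idem (z := v * y₁.prod) (hmul _ hu.2 _ hu.2) hux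
          (hzf.mono (Nat.le_succ _)) (val u x hu.2 fun z hz => (hl z (by simp [hz])).2)
          ((val v y₁ (hv ▸ hu.2) fun z hz => (hl z (by simp [hz])).2).trans hv) hz).mul
          (hyf.mono (Nat.le_add_right _ 2))
        simpa [mul_assoc] using this.mono (Nat.le_succ _)

/-- The elements of `N` that fix `q` by right multiplication. -/
def rightStabilizer (N : Submonoid M) (q : M) : Submonoid M where
  carrier := {x | x ∈ N ∧ q * x = q}
  one_mem' := ⟨N.one_mem, mul_one q⟩
  mul_mem' := fun {a b} ha hb => ⟨N.mul_mem ha.1 hb.1, by rw [← mul_assoc, ha.2, hb.2]⟩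

theorem card_rightStabilizer_lt [Finite M] {N : Submonoid M} {q x : M} (hx : x ∈ N)
    (hq : q * x ≠ q) : Nat.card (rightStabilizer N q) < Nat.card N := by
  refine Set.ncard_lt_ncard (s := (rightStabilizer N q : Set M)) (t := (N : Set M)) ?_
    (Set.toFinite _)
  exact ⟨fun y hy => hy.1, fun h => hq (h hx).2⟩

/-- For submonoids of at most `n` elements, products of words of height `h` whose images lie in the
submonoid have forests of height bounded in terms of `h`. -/
def BoundedForests (α : FreeMonoid A →* M) (n : ℕ) : Prop :=
  ∀ h, ∃ h', ∀ N : Submonoid M, Nat.card N ≤ n → ∀ ws : List (FreeMonoid A),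
    (∀ w ∈ ws, HasForest α h w ∧ α w ∈ N) → HasForest α h' ws.prod

/-- Bounded height for products along which the state, started at `q` and multiplied on the right,
stays in a set `S` of elements that are not left zeros of `N`. A run is cut at its returns to the
first state: the loops have images in a stabilizer, a proper submonoid, and each loop avoids that
state in its interior, so that the set `S` shrinks. -/
theorem BoundedForests.exists_of_avoiding [Finite M] {α : FreeMonoid A →* M} {n : ℕ}
    (hn : BoundedForests α n) (m h : ℕ) :
    ∃ h', ∀ (N : Submonoid M) (S : Finset M), Nat.card N ≤ n + 1 → S.card ≤ m →
      (∀ s ∈ S, ∃ x ∈ N, s * x ≠ s) → ∀ (q : M) (ws : List (FreeMonoid A)),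
        (∀ w ∈ ws, HasForest α h w ∧ α w ∈ N) →
        (∀ p, p <+: ws → p ≠ [] → q * α p.prod ∈ S) → HasForest α h' ws.prod := by
  classical
  induction m with
  | zero =>
    refine ⟨0, fun N S _ hS _ q ws _ hp => ?_⟩
    cases ws with
    | nil => exact HasForest.one
    | cons u us =>
      have := hp _ (List.prefix_refl _) (by simp)
      simp_all
  | succ m ih =>
    obtain ⟨h₁, ih⟩ := ih
    obtain ⟨h₂, hn⟩ := hn (max h h₁ + 1)
    refine ⟨max h (max h₁ h₂) + 2, fun N S hN hS hstab q ws hws hp => ?_⟩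
    cases ws with
    | nil => exact HasForest.one
    | cons b rest =>
      obtain ⟨q', hq'⟩ : ∃ q', q' = q * α b := ⟨_, rfl⟩
      have hq'S : q' ∈ S := by simpa [hq'] using hp [b] (by simp) (by simp)
      have hrest : ∀ p, p <+: rest → q' * α p.prod ∈ S := by
        intro p hpp
        simpa [hq', mul_assoc] using hp (b :: p) (by simpa using hpp) (by simp)
      have hrest' : ∀ w ∈ rest, HasForest α h w ∧ α w ∈ N := fun w hw => hws w (by simp [hw])
      have hcard : (S.erase q').card ≤ m := by
        rw [Finset.card_erase_of_mem hq'S]; omega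
      have tailForest : ∀ tl : List (FreeMonoid A), (∀ w ∈ tl, HasForest α h w ∧ α w ∈ N) →
          (∀ p, p <+: tl → p ≠ [] → q' * α p.prod ∈ S.erase q') → HasForest α h₁ tl.prod :=
        fun tl h1 h2 => ih N (S.erase q') hN hcard
          (fun s hs => hstab s (Finset.mem_of_mem_erase hs)) q' tl h1 h2
      -- Cut `rest` at its returns to the state `q'`.
      obtain ⟨bs, tl, hprod, hbs, htl, htlp⟩ : ∃ bs tl : List (FreeMonoid A),
          rest.prod = bs.prod * tl.prod ∧
          (∀ w ∈ bs, HasForest α (max h h₁ + 1) w ∧ α w ∈ rightStabilizer N q') ∧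
          (∀ w ∈ tl, HasForest α h w ∧ α w ∈ N) ∧
          (∀ p, p <+: tl → p ≠ [] → q' * α p.prod ∈ S.erase q') := by
        clear hp hws
        induction rest using List.reverseRecOn with
        | nil => exact ⟨[], [], by simp⟩
        | append_singleton l w ihl =>
          obtain ⟨bs, tl, hprod, hbs, htl, htlp⟩ := ihl
            (fun p hpp => hrest p (hpp.trans (List.prefix_append _ _)))
            (fun w hw => hrest' w (by simp [hw]))
          have hw := hrest' w (by simp)
          have hbs' : q' * α bs.prod = q' := by
            rw [map_list_prod]
            exact (Submonoid.list_prod_mem (rightStabilizer N q') (by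
              simp only [List.mem_map]; rintro x ⟨y, hy, rfl⟩; exact (hbs y hy).2)).2
          have hmem : q' * α (tl.prod * w) ∈ S := by
            have := hrest _ (List.prefix_refl _)
            rwa [List.prod_append, hprod, List.prod_singleton, mul_assoc, map_mul, ← mul_assoc,
              hbs'] at this
          by_cases hret : q' * α (tl.prod * w) = q'
          · refine ⟨bs ++ [tl.prod * w], [], by simp [hprod, mul_assoc], ?_, by simp, by simp⟩
            intro x hx
            rcases List.mem_append.1 hx with hx | hx
            · exact hbs x hx
            · rw [List.mem_singleton.1 hx]
              refine ⟨((tailForest tl htl htlp).mono (le_max_right _ _)).mul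
                (hw.1.mono (le_max_left _ _)), ?_, hret⟩
              rw [map_mul, map_list_prod]
              exact N.mul_mem (N.list_prod_mem (by
                simp only [List.mem_map]; rintro x ⟨y, hy, rfl⟩; exact (htl y hy).2)) hw.2
          · refine ⟨bs, tl ++ [w], by simp [hprod, mul_assoc], hbs, ?_, ?_⟩
            · intro x hx
              rcases List.mem_append.1 hx with hx | hx
              · exact htl x hx
              · rw [List.mem_singleton.1 hx]; exact hw
            · intro p hpp hp0
              rcases List.prefix_concat_iff.1 hpp with rfl | hpp
              · rw [List.prod_append, List.prod_singleton]
                exact Finset.mem_erase.2 ⟨hret, hmem⟩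
              · exact htlp p hpp hp0
      obtain ⟨x, hx, hqx⟩ := hstab q' hq'S
      have hlt := card_rightStabilizer_lt hx hqx
      have h1 := hn (rightStabilizer N q') (by omega) bs hbs
      have h2 := tailForest tl htl htlp
      rw [List.prod_cons, hprod]
      exact ((hws b (by simp)).1.mono (by omega)).mul
        ((h1.mono (h' := max h (max h₁ h₂)) (by omega)).mul (h2.mono (by omega)))

/-- A product is cut greedily into blocks whose images are left zeros of `N`: strictly inside a
block no left zero is reached, and the product of the blocks is a product of left zeros. -/
theorem boundedForests [Finite M] (α : FreeMonoid A →* M) (n : ℕ) : BoundedForests α n := by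
  classical
  have := Fintype.ofFinite M
  induction n with
  | zero =>
    intro h
    refine ⟨0, fun N hN => ?_⟩
    have : 0 < Nat.card N := Nat.card_pos
    omega
  | succ n ih =>
    intro h
    obtain ⟨h₁, hav⟩ := ih.exists_of_avoiding (Fintype.card M) h
    obtain ⟨h₂, hlz⟩ := exists_hasForest_of_leftZero α (Fintype.card M) (max h h₁ + 1)
    refine ⟨max h₁ h₂ + 1, fun N hN ws hws => ?_⟩
    -- The left zeros of `N`.
    let Z : Finset M := Finset.univ.filter fun q => q ∈ N ∧ ∀ x ∈ N, q * x = q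
    have tailForest : ∀ tl : List (FreeMonoid A), (∀ w ∈ tl, HasForest α h w ∧ α w ∈ N) →
        (∀ p, p <+: tl → p ≠ [] → α p.prod ∉ Z) → HasForest α h₁ tl.prod := by
      intro tl h1 h2
      refine hav N (Finset.univ.filter fun q => ∃ x ∈ N, q * x ≠ q) hN (Finset.card_le_univ _)
        (fun s hs => by simpa using hs) 1 tl h1 fun p hp hp0 => ?_
      have h3 := h2 p hp hp0
      have h4 : α p.prod ∈ N := by
        rw [map_list_prod]
        exact N.list_prod_mem (by
          simp only [List.mem_map]; rintro x ⟨y, hy, rfl⟩; exact (h1 y (hp.subset hy)).2)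
      simp only [Z, Finset.mem_filter, Finset.mem_univ, true_and, not_and, not_forall] at h3
      simpa using h3 h4
    obtain ⟨bs, tl, hprod, hbs, htl, htlp⟩ : ∃ bs tl : List (FreeMonoid A),
        ws.prod = bs.prod * tl.prod ∧
        (∀ w ∈ bs, HasForest α (max h h₁ + 1) w ∧ α w ∈ Z) ∧
        (∀ w ∈ tl, HasForest α h w ∧ α w ∈ N) ∧
        (∀ p, p <+: tl → p ≠ [] → α p.prod ∉ Z) := by
      induction ws using List.reverseRecOn with
      | nil => exact ⟨[], [], by simp⟩
      | append_singleton l w ihl =>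
        obtain ⟨bs, tl, hprod, hbs, htl, htlp⟩ := ihl (fun w hw => hws w (by simp [hw]))
        have hw := hws w (by simp)
        by_cases hret : α (tl.prod * w) ∈ Z
        · refine ⟨bs ++ [tl.prod * w], [], by simp [hprod, mul_assoc], ?_, by simp, by simp⟩
          intro x hx
          rcases List.mem_append.1 hx with hx | hx
          · exact hbs x hx
          · rw [List.mem_singleton.1 hx]
            exact ⟨((tailForest tl htl htlp).mono (le_max_right _ _)).mul
              (hw.1.mono (le_max_left _ _)), hret⟩
        · refine ⟨bs, tl ++ [w], by simp [hprod, mul_assoc], hbs, ?_, ?_⟩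
          · intro x hx
            rcases List.mem_append.1 hx with hx | hx
            · exact htl x hx
            · rw [List.mem_singleton.1 hx]; exact hw
          · intro p hpp hp0
            rcases List.prefix_concat_iff.1 hpp with rfl | hpp
            · rwa [List.prod_append, List.prod_singleton]
            · exact htlp p hpp hp0
    have hZ : ∀ q ∈ Z, ∀ q' ∈ Z, q * q' = q := by
      intro q hq q' hq'
      simp only [Z, Finset.mem_filter, Finset.mem_univ, true_and] at hq hq'
      exact hq.2 q' hq'.1
    rw [hprod]
    exact ((hlz Z (Finset.card_le_univ _) hZ bs hbs).mono (le_max_right _ _)).mul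
      ((tailForest tl htl htlp).mono (le_max_left _ _))

/-- For a morphism to a finite monoid, all words have forests of a common height. -/
theorem exists_forall_hasForest [Finite M] (α : FreeMonoid A →* M) :
    ∃ h, ∀ w : FreeMonoid A, HasForest α h w := by
  obtain ⟨h, hh⟩ := boundedForests α (Nat.card (⊤ : Submonoid M)) 0
  refine ⟨h, fun w => ?_⟩
  have := hh ⊤ le_rfl (w.toList.map FreeMonoid.of) fun x hx => by
    obtain ⟨a, -, rfl⟩ := List.mem_map.1 hx
    exact ⟨HasForest.of a, Submonoid.mem_top _⟩
  have key : ∀ l : List A, (l.map FreeMonoid.of).prod = FreeMonoid.ofList l := by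
    intro l
    induction l with
    | nil => rfl
    | cons a l ih => rw [List.map_cons, List.prod_cons, ih, FreeMonoid.ofList_cons]
  rwa [key, FreeMonoid.ofList_toList] at this

end Forest

/-! ### The alternation game on words -/

section Game
variable {A : Type*}

open FreeMonoid (of)

/-- The preorder of the `k`-round game for `Σ_i`, on words. A move picks a position of the first
word, which splits it as `u a v`; the answer is a split `u' a v'` of the second word, and the play
goes on for both pairs of factors, since later moves fall on one side of that position. The
first conjunct lets the roles of the two words be exchanged, at the price of one level. -/
def GameLE : ℕ → ℕ → FreeMonoid A → FreeMonoid A → Prop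
  | 0, _, _, _ => True
  | _ + 1, 0, _, _ => True
  | i + 1, k + 1, w, w' => GameLE i (k + 1) w' w ∧
      ∀ (u : FreeMonoid A) (a : A) (v : FreeMonoid A), w = u * of a * v →
        ∃ u' v', w' = u' * of a * v' ∧ GameLE (i + 1) k u u' ∧ GameLE (i + 1) k v v'
termination_by i k => (i, k)

theorem gameLE_zero_left (k : ℕ) (w w' : FreeMonoid A) : GameLE 0 k w w' := by
  rw [GameLE]; trivial

theorem gameLE_zero_right (i : ℕ) (w w' : FreeMonoid A) : GameLE i 0 w w' := by
  cases i <;> · rw [GameLE]; trivial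

theorem gameLE_succ_succ {i k : ℕ} {w w' : FreeMonoid A} :
    GameLE (i + 1) (k + 1) w w' ↔ GameLE i (k + 1) w' w ∧
      ∀ (u : FreeMonoid A) (a : A) (v : FreeMonoid A), w = u * of a * v →
        ∃ u' v', w' = u' * of a * v' ∧ GameLE (i + 1) k u u' ∧ GameLE (i + 1) k v v' := by
  conv_lhs => rw [GameLE]

theorem GameLE.swap {i k : ℕ} {w w' : FreeMonoid A} (h : GameLE (i + 1) k w w') :
    GameLE i k w' w := by
  cases k with
  | zero => exact gameLE_zero_right _ _ _
  | succ k => exact (gameLE_succ_succ.1 h).1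

theorem GameLE.refl (i k : ℕ) (w : FreeMonoid A) : GameLE i k w w := by
  induction i generalizing k w with
  | zero => exact gameLE_zero_left _ _ _
  | succ i ihi =>
    induction k generalizing w with
    | zero => exact gameLE_zero_right _ _ _
    | succ k ihk =>
      exact gameLE_succ_succ.2 ⟨ihi _ _, fun u a v h => ⟨u, v, h, ihk u, ihk v⟩⟩

theorem GameLE.trans {i k : ℕ} {w₁ w₂ w₃ : FreeMonoid A} (h : GameLE i k w₁ w₂)
    (h' : GameLE i k w₂ w₃) : GameLE i k w₁ w₃ := by
  induction i generalizing k w₁ w₂ w₃ with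
  | zero => exact gameLE_zero_left _ _ _
  | succ i ihi =>
    induction k generalizing w₁ w₂ w₃ with
    | zero => exact gameLE_zero_right _ _ _
    | succ k ihk =>
      rw [gameLE_succ_succ] at h h' ⊢
      refine ⟨ihi h'.1 h.1, fun u a v hw => ?_⟩
      obtain ⟨u', v', hw', hu, hv⟩ := h.2 u a v hw
      obtain ⟨u'', v'', hw'', hu', hv'⟩ := h'.2 u' a v' hw'
      exact ⟨u'', v'', hw'', ihk hu hu', ihk hv hv'⟩

theorem GameLE.of_succ {i k : ℕ} {w w' : FreeMonoid A} (h : GameLE i (k + 1) w w') :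
    GameLE i k w w' := by
  induction i generalizing k w w' with
  | zero => exact gameLE_zero_left _ _ _
  | succ i ihi =>
    induction k generalizing w w' with
    | zero => exact gameLE_zero_right _ _ _
    | succ k ihk =>
      rw [gameLE_succ_succ] at h ⊢
      refine ⟨ihi h.1, fun u a v hw => ?_⟩
      obtain ⟨u', v', hw', hu, hv⟩ := h.2 u a v hw
      exact ⟨u', v', hw', ihk hu, ihk hv⟩

theorem GameLE.mono {i k k' : ℕ} {w w' : FreeMonoid A} (h : GameLE i k' w w') (hk : k ≤ k') :
    GameLE i k w w' := by
  induction hk with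
  | refl => exact h
  | step _ ih => exact ih h.of_succ

/-- A position of `u * v` lies in `u` or in `v`. -/
theorem mul_of_mul_eq_mul {x y u v : FreeMonoid A} {a : A} (h : u * v = x * of a * y) :
    (∃ z, u = x * of a * z ∧ y = z * v) ∨ ∃ z, v = z * of a * y ∧ x = u * z := by
  have h' : u.toList ++ v.toList = x.toList ++ a :: y.toList := by
    simpa using congrArg FreeMonoid.toList h
  rcases List.append_eq_append_iff.1 h' with ⟨z, h1, h2⟩ | ⟨z, h1, h2⟩
  · exact Or.inr ⟨FreeMonoid.ofList z, FreeMonoid.toList.injective (by simpa using h2),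
      FreeMonoid.toList.injective (by simpa using h1)⟩
  · cases z with
    | nil =>
      exact Or.inr ⟨1, FreeMonoid.toList.injective (by simpa using h2.symm),
        FreeMonoid.toList.injective (by simpa using h1.symm)⟩
    | cons b z =>
      obtain ⟨rfl, h2⟩ : a = b ∧ y.toList = z ++ v.toList := by simpa using h2
      exact Or.inl ⟨FreeMonoid.ofList z, FreeMonoid.toList.injective (by simpa using h1),
        FreeMonoid.toList.injective (by simpa using h2)⟩

theorem GameLE.mul {i k : ℕ} {u u' v v' : FreeMonoid A} (h : GameLE i k u u')
    (h' : GameLE i k v v') : GameLE i k (u * v) (u' * v') := by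
  induction i generalizing k u u' v v' with
  | zero => exact gameLE_zero_left _ _ _
  | succ i ihi =>
    induction k generalizing u u' v v' with
    | zero => exact gameLE_zero_right _ _ _
    | succ k ihk =>
      have hu := h.of_succ
      have hv := h'.of_succ
      rw [gameLE_succ_succ] at h h' ⊢
      refine ⟨ihi h.1 h'.1, fun x a y hw => ?_⟩
      rcases mul_of_mul_eq_mul hw with ⟨z, hz, rfl⟩ | ⟨z, hz, rfl⟩
      · obtain ⟨x', z', rfl, h1, h2⟩ := h.2 x a z hz
        exact ⟨x', z' * v', by simp [mul_assoc], h1, ihk h2 hv⟩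
      · obtain ⟨z', y', rfl, h1, h2⟩ := h'.2 z a y hz
        exact ⟨u' * z', y', by simp [mul_assoc], ihk hu h1, h2⟩

/-- A binary cut is answered at the cost of one round, by picking the first letter of `v`. -/
theorem GameLE.exists_mul {i k : ℕ} {u v w : FreeMonoid A} (h : GameLE (i + 1) (k + 1) (u * v) w) :
    ∃ u' v', w = u' * v' ∧ GameLE (i + 1) k u u' ∧ GameLE (i + 1) k v v' := by
  induction v using FreeMonoid.casesOn with
  | one => exact ⟨w, 1, by simp, by simpa using h.of_succ, GameLE.refl _ _ _⟩
  | of_mul a v =>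
    obtain ⟨u', v', hw, h1, h2⟩ := (gameLE_succ_succ.1 h).2 u a v (by simp [mul_assoc])
    exact ⟨u', of a * v', by simp [hw, mul_assoc], h1, (GameLE.refl _ _ _).mul h2⟩

/-- A position of `v ^ n` lies in one copy of `v`. -/
theorem pow_eq_mul_of_mul {v x y : FreeMonoid A} {a : A} {n : ℕ} (h : v ^ n = x * of a * y) :
    ∃ j j' x₀ y₀, n = j + 1 + j' ∧ v = x₀ * of a * y₀ ∧ x = v ^ j * x₀ ∧ y = y₀ * v ^ j' := by
  induction n generalizing x with
  | zero =>
    have := congrArg FreeMonoid.length h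
    simp only [pow_zero, FreeMonoid.length_one, FreeMonoid.length_mul, FreeMonoid.length_of]
      at this
    omega
  | succ n ih =>
    rw [pow_succ'] at h
    rcases mul_of_mul_eq_mul h with ⟨z, hz, rfl⟩ | ⟨z, hz, rfl⟩
    · exact ⟨0, n, x, z, by omega, hz, by simp, rfl⟩
    · obtain ⟨j, j', x₀, y₀, rfl, hv, rfl, rfl⟩ := ih hz
      exact ⟨j + 1, j', x₀, y₀, by omega, hv, by rw [pow_succ', mul_assoc], rfl⟩

/-- Powers with at least `2 ^ k - 1` factors are not distinguished in `k` rounds. -/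
theorem gameLE_pow_pow (i : ℕ) {k n m : ℕ} (v : FreeMonoid A) (hn : 2 ^ k ≤ n + 1)
    (hm : 2 ^ k ≤ m + 1) : GameLE i k (v ^ n) (v ^ m) := by
  induction i generalizing k n m with
  | zero => exact gameLE_zero_left _ _ _
  | succ i ihi =>
    induction k generalizing n m with
    | zero => exact gameLE_zero_right _ _ _
    | succ k ihk =>
      refine gameLE_succ_succ.2 ⟨ihi hm hn, fun x a y hw => ?_⟩
      obtain ⟨j, j', x₀, y₀, rfl, hv, rfl, rfl⟩ := pow_eq_mul_of_mul hw
      have key : ∀ l l', m = l + 1 + l' → (j = l ∨ 2 ^ k ≤ j + 1 ∧ 2 ^ k ≤ l + 1) →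
          (j' = l' ∨ 2 ^ k ≤ j' + 1 ∧ 2 ^ k ≤ l' + 1) →
          ∃ u' v', v ^ m = u' * of a * v' ∧ GameLE (i + 1) k (v ^ j * x₀) u' ∧
            GameLE (i + 1) k (y₀ * v ^ j') v' := by
        rintro l l' rfl hl hl'
        refine ⟨v ^ l * x₀, y₀ * v ^ l', ?_, GameLE.mul ?_ (GameLE.refl _ _ _),
          (GameLE.refl _ _ _).mul ?_⟩
        · rw [pow_add, pow_succ]; nth_rewrite 2 [hv]; simp only [mul_assoc]
        · rcases hl with rfl | ⟨h1, h2⟩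
          · exact GameLE.refl _ _ _
          · exact ihk h1 h2
        · rcases hl' with rfl | ⟨h1, h2⟩
          · exact GameLE.refl _ _ _
          · exact ihk h1 h2
      have h2 : 2 ^ (k + 1) = 2 * 2 ^ k := pow_succ' _ _
      have h1 : 0 < 2 ^ k := by positivity
      by_cases hj : j + 1 < 2 ^ k
      · exact key j (m - 1 - j) (by omega) (Or.inl rfl) (Or.inr (by omega))
      by_cases hj' : j' + 1 < 2 ^ k
      · exact key (m - 1 - j') j' (by omega) (Or.inr (by omega)) (Or.inl rfl)
      · exact key (2 ^ k - 1) (m - 2 ^ k) (by omega) (Or.inr (by omega)) (Or.inr (by omega))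

/-- If `t` is below `v` at level `i`, then inserting `t` inside a large power of `v` goes up at level
`i + 1`. A position of the copy number `j` of `v` is answered on the left of `t` if enough copies
follow it, and on the right otherwise; in both cases the side that contains `t` keeps enough copies
of `v` around it. -/
theorem GameLE.pow_pow_mul_pow {i k n m m' : ℕ} {t v : FreeMonoid A} (h : GameLE i k t v)
    (hn : 2 ^ k ≤ n + 1) (hm : 2 ^ k ≤ m + 1) (hm' : 2 ^ k ≤ m' + 1) :
    GameLE (i + 1) k (v ^ n) (v ^ m * t * v ^ m') := by
  induction k generalizing n m m' with
  | zero => exact gameLE_zero_right _ _ _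
  | succ k ihk =>
    have h2 : 2 ^ (k + 1) = 2 * 2 ^ k := pow_succ' _ _
    have h1 : 0 < 2 ^ k := by positivity
    refine gameLE_succ_succ.2 ⟨?_, fun x a y hw => ?_⟩
    · have h3 := gameLE_pow_pow i v (k := k + 1) (n := m + 1 + m') (by omega) hn
      rw [pow_add, pow_succ] at h3
      exact (((GameLE.refl _ _ _).mul h).mul (GameLE.refl _ _ _)).trans h3
    obtain ⟨j, j', x₀, y₀, rfl, hv, rfl, rfl⟩ := pow_eq_mul_of_mul hw
    by_cases hj' : 2 ^ k ≤ j' + 1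
    · obtain ⟨l, l', hl, hl', hjl⟩ : ∃ l l', m = l + 1 + l' ∧ 2 ^ k ≤ l' + 1 ∧
          (j = l ∨ 2 ^ k ≤ j + 1 ∧ 2 ^ k ≤ l + 1) := by
        by_cases hj : j + 1 < 2 ^ k
        · exact ⟨j, m - 1 - j, by omega, by omega, Or.inl rfl⟩
        · exact ⟨2 ^ k - 1, m - 2 ^ k, by omega, by omega, Or.inr (by omega)⟩
      refine ⟨v ^ l * x₀, y₀ * (v ^ l' * t * v ^ m'), ?_, GameLE.mul ?_ (GameLE.refl _ _ _),
          (GameLE.refl _ _ _).mul (ihk h.of_succ hj' hl' (by omega))⟩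
      · rw [hl, pow_add, pow_succ]; nth_rewrite 2 [hv]; simp only [mul_assoc]
      · rcases hjl with rfl | ⟨h1, h2⟩
        · exact GameLE.refl _ _ _
        · exact gameLE_pow_pow _ _ h1 h2
    · refine ⟨v ^ m * t * v ^ (m' - 1 - j') * x₀, y₀ * v ^ j', ?_,
        (ihk h.of_succ (by omega) (by omega) (by omega)).mul (GameLE.refl _ _ _),
        GameLE.refl _ _ _⟩
      have : m' = (m' - 1 - j') + 1 + j' := by omega
      nth_rewrite 1 [this]
      rw [pow_add, pow_succ]; nth_rewrite 3 [hv]; simp only [mul_assoc]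

end Game

/-! ### Factors between marks -/

section Factor
variable {A : Type*}
open FreeMonoid (of ofList)

/-- The factor of `w` strictly between the marks `p` and `q`. Marks number the positions from `1`,
so that `0` and `w.toList.length + 1` mark the two ends of the word. -/
def factor (w : FreeMonoid A) (p q : ℕ) : FreeMonoid A :=
  ofList ((w.toList.take (q - 1)).drop p)

theorem factor_zero_length (w : FreeMonoid A) : factor w 0 (w.toList.length + 1) = w := by
  simp [factor]

theorem factor_eq_mul {w u v : FreeMonoid A} {a : A} {p q : ℕ} (hq : q ≤ w.toList.length + 1)
    (h : factor w p q = u * of a * v) :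
    ∃ x, p < x ∧ x < q ∧ w.toList[x - 1]? = some a ∧ factor w p x = u ∧ factor w x q = v := by
  have h' : (w.toList.take (q - 1)).drop p = u.toList ++ a :: v.toList := by
    simpa [factor] using congrArg FreeMonoid.toList h
  have hlen : q - 1 = p + (u.toList.length + 1 + v.toList.length) := by
    have := congrArg List.length h'
    simp only [List.length_drop, List.length_take, List.length_append, List.length_cons] at this
    omega
  have hw : w.toList = w.toList.take p ++ (u.toList ++ a :: v.toList) ++
      w.toList.drop (q - 1) := by
    have e : w.toList.take p = (w.toList.take (q - 1)).take p := by
      rw [List.take_take, min_eq_left (by omega)]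
    rw [← h', e, List.take_append_drop, List.take_append_drop]
  have hp : (w.toList.take p).length = p := by rw [List.length_take]; omega
  refine ⟨p + u.toList.length + 1, by omega, by omega, ?_, ?_, ?_⟩
  · rw [hw]
    rw [Nat.add_sub_cancel, List.getElem?_append_left (by simp; omega),
      List.getElem?_append_right (by omega)]
    simp [hp]
  · apply FreeMonoid.toList.injective
    have e : (w.toList.take (p + u.toList.length)).drop p =
        ((w.toList.take (q - 1)).drop p).take u.toList.length := by
      rw [List.drop_take, List.drop_take, List.take_take]; congr 1; omega
    simp only [factor, FreeMonoid.toList_ofList, Nat.add_sub_cancel, e, h']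
    simp
  · apply FreeMonoid.toList.injective
    have e : (w.toList.take (q - 1)).drop (p + u.toList.length + 1) =
        ((w.toList.take (q - 1)).drop p).drop (u.toList.length + 1) := by
      rw [List.drop_drop, add_assoc]
    simp only [factor, FreeMonoid.toList_ofList, e, h']
    simp

theorem factor_eq_factor_mul {w : FreeMonoid A} {a : A} {p x q : ℕ} (hpx : p < x) (hxq : x < q)
    (hq : q ≤ w.toList.length + 1) (ha : w.toList[x - 1]? = some a) :
    factor w p q = factor w p x * of a * factor w x q := by
  apply FreeMonoid.toList.injective
  simp only [factor, FreeMonoid.toList_ofList, FreeMonoid.toList_mul, FreeMonoid.toList_of]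
  have e1 : ((w.toList.take (q - 1)).drop p).take (x - 1 - p) =
      (w.toList.take (x - 1)).drop p := by
    rw [List.drop_take, List.drop_take, List.take_take]; congr 1; omega
  have e2 : ((w.toList.take (q - 1)).drop p).drop (x - 1 - p) =
      a :: (w.toList.take (q - 1)).drop x := by
    have hx : x - 1 < (w.toList.take (q - 1)).length := by rw [List.length_take]; omega
    rw [List.drop_drop, show p + (x - 1 - p) = x - 1 by omega, List.drop_eq_getElem_cons hx,
      show x - 1 + 1 = x by omega]
    congr 1
    rw [List.getElem_take]
    exact (List.getElem?_eq_some_iff.1 ha).2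
  rw [← List.take_append_drop (x - 1 - p) ((w.toList.take (q - 1)).drop p), e1, e2]
  simp

end Factor

/-! ### Formulas are preserved by the game -/

section Soundness
variable {A : Type*}
open FreeMonoid (of)
open FirstOrder Language

/-- Satisfaction of a formula in a word, under an assignment of positions to its variables. -/
def Sat {n : ℕ} (w : FreeMonoid A) (φ : (wordLang A).BoundedFormula Empty n)
    (xs : Fin n → Fin w.toList.length) : Prop :=
  @BoundedFormula.Realize (wordLang A) (Fin w.toList.length) (wordStructure w.toList) Empty n φ
    default xs

/-- A position of the game with marked positions: a finite set `S` of pairs of corresponding marks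
of `w` and `w'`, containing the ends, that respects order and letters, and such that the factors
between consecutive marks are comparable in the game on words. -/
structure MatchedMarks (i k : ℕ) (w w' : FreeMonoid A) (S : Finset (ℕ × ℕ)) : Prop where
  zero_mem : (0, 0) ∈ S
  end_mem : (w.toList.length + 1, w'.toList.length + 1) ∈ S
  fst_le : ∀ p ∈ S, p.1 ≤ w.toList.length + 1
  snd_le : ∀ p ∈ S, p.2 ≤ w'.toList.length + 1
  lt_iff : ∀ p ∈ S, ∀ q ∈ S, p.1 < q.1 ↔ p.2 < q.2
  letter : ∀ p ∈ S, p.1 ≠ 0 → w.toList[p.1 - 1]? = w'.toList[p.2 - 1]?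
  gap : ∀ p ∈ S, ∀ q ∈ S, p.1 < q.1 → (∀ r ∈ S, p.1 < r.1 → q.1 ≤ r.1) →
    GameLE i k (factor w p.1 q.1) (factor w' p.2 q.2)

theorem MatchedMarks.swap {i k : ℕ} {w w' : FreeMonoid A} {S : Finset (ℕ × ℕ)}
    (h : MatchedMarks (i + 1) k w w' S) : MatchedMarks i k w' w (S.image Prod.swap) where
  zero_mem := by simpa using h.zero_mem
  end_mem := by simpa using h.end_mem
  fst_le := by
    simp only [Finset.mem_image]; rintro _ ⟨p, hp, rfl⟩; exact h.snd_le p hp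
  snd_le := by
    simp only [Finset.mem_image]; rintro _ ⟨p, hp, rfl⟩; exact h.fst_le p hp
  lt_iff := by
    simp only [Finset.mem_image]; rintro _ ⟨p, hp, rfl⟩ _ ⟨q, hq, rfl⟩
    exact (h.lt_iff p hp q hq).symm
  letter := by
    simp only [Finset.mem_image]; rintro _ ⟨p, hp, rfl⟩ h0
    have := h.lt_iff _ h.zero_mem p hp
    refine (h.letter p hp ?_).symm
    simp only [Prod.fst_swap] at h0
    omega
  gap := by
    simp only [Finset.mem_image]; rintro _ ⟨p, hp, rfl⟩ _ ⟨q, hq, rfl⟩ hlt hgap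
    refine (h.gap p hp q hq ((h.lt_iff p hp q hq).2 hlt) fun r hr hpr => ?_).swap
    have h1 := hgap _ ⟨r, hr, rfl⟩ ((h.lt_iff p hp r hr).1 hpr)
    have h2 := h.lt_iff r hr q hq
    simp only [Prod.fst_swap] at h1
    omega

/-- A new mark of `w` is answered inside the gap that contains it. -/
theorem MatchedMarks.extend {i k : ℕ} {w w' : FreeMonoid A} {S : Finset (ℕ × ℕ)}
    (h : MatchedMarks (i + 1) (k + 1) w w' S) (x : Fin w.toList.length) :
    ∃ (y : Fin w'.toList.length) (S' : Finset (ℕ × ℕ)), S ⊆ S' ∧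
      ((x : ℕ) + 1, (y : ℕ) + 1) ∈ S' ∧ MatchedMarks (i + 1) k w w' S' := by
  classical
  have hmono : MatchedMarks (i + 1) k w w' S :=
    ⟨h.1, h.2, h.3, h.4, h.5, h.6, fun p hp q hq h1 h2 => (h.7 p hp q hq h1 h2).of_succ⟩
  have hx := x.isLt
  by_cases hxS : ∃ p ∈ S, p.1 = (x : ℕ) + 1
  · obtain ⟨⟨p, q⟩, hp, rfl⟩ := hxS
    have h1 := h.lt_iff _ h.zero_mem _ hp
    have h2 := h.lt_iff _ hp _ h.end_mem
    simp only at h1 h2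
    refine ⟨⟨q - 1, by omega⟩, S, subset_rfl, ?_, hmono⟩
    rwa [show q - 1 + 1 = q by omega]
  simp only [not_exists, not_and] at hxS
  -- `l` and `r` are the matched marks next to the new one.
  obtain ⟨l, hl, hlmax⟩ := (S.filter fun p => p.1 < (x : ℕ) + 1).exists_max_image Prod.fst
    ⟨(0, 0), Finset.mem_filter.2 ⟨h.zero_mem, by simp⟩⟩
  obtain ⟨r, hr, hrmin⟩ := (S.filter fun p => (x : ℕ) + 1 < p.1).exists_min_image Prod.fst
    ⟨_, Finset.mem_filter.2 ⟨h.end_mem, by simp⟩⟩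
  simp only [Finset.mem_filter] at hl hlmax hr hrmin
  have hlx : ∀ p ∈ S, p.1 ≤ l.1 ∨ r.1 ≤ p.1 := by
    intro p hp
    have h1 := hlmax p
    have h2 := hrmin p
    have h3 := hxS p hp
    rcases lt_or_ge p.1 ((x : ℕ) + 1) with h4 | h4
    · exact Or.inl (h1 ⟨hp, h4⟩)
    · exact Or.inr (h2 ⟨hp, by omega⟩)
  have hg := h.gap l hl.1 r hr.1 (by omega) fun p hp hpl => by
    rcases hlx p hp with h1 | h1 <;> omega
  have hxa : w.toList[(x : ℕ) + 1 - 1]? = some w.toList[(x : ℕ)] := by simp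
  obtain ⟨u', v', heq, hu, hv⟩ := (gameLE_succ_succ.1 hg).2 _ _ _
    (factor_eq_factor_mul hl.2 hr.2 (h.fst_le r hr.1) hxa)
  obtain ⟨y, hly, hyr, hya, rfl, rfl⟩ := factor_eq_mul (h.snd_le r hr.1) heq
  have hyle := h.snd_le r hr.1
  have hlt_snd : ∀ p ∈ S, (p.1 < (x : ℕ) + 1 → p.2 ≤ l.2) ∧ ((x : ℕ) + 1 < p.1 → r.2 ≤ p.2) := by
    intro p hp
    have h1 := hlx p hp
    have h2 := h.lt_iff l hl.1 p hp
    have h3 := h.lt_iff p hp r hr.1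
    constructor <;> intro h4 <;> omega
  refine ⟨⟨y - 1, by omega⟩, insert ((x : ℕ) + 1, y) S, Finset.subset_insert _ _, ?_, ?_⟩
  · rw [show y - 1 + 1 = y by omega]; exact Finset.mem_insert_self _ _
  constructor
  · exact Finset.mem_insert_of_mem h.zero_mem
  · exact Finset.mem_insert_of_mem h.end_mem
  · intro p hp
    rcases Finset.mem_insert.1 hp with rfl | hp
    · simp only; omega
    · exact h.fst_le p hp
  · intro p hp
    rcases Finset.mem_insert.1 hp with rfl | hp
    · simp only; omega
    · exact h.snd_le p hp
  · intro p hp q hq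
    rcases Finset.mem_insert.1 hp with rfl | hp <;> rcases Finset.mem_insert.1 hq with rfl | hq
    · simp
    · have h1 := hlt_snd q hq
      have h2 := hxS q hq
      simp only; omega
    · have h1 := hlt_snd p hp
      have h2 := hxS p hp
      simp only; omega
    · exact h.lt_iff p hp q hq
  · intro p hp h0
    rcases Finset.mem_insert.1 hp with rfl | hp
    · rw [hxa, hya]
    · exact h.letter p hp h0
  · intro p hp q hq hpq hgap
    have hgap' : ∀ r ∈ S, p.1 < r.1 → q.1 ≤ r.1 := fun r hr =>
      hgap r (Finset.mem_insert_of_mem hr)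
    rcases Finset.mem_insert.1 hp with rfl | hp <;> rcases Finset.mem_insert.1 hq with rfl | hq
    · simp at hpq
    · have h1 := hgap' r hr.1 hr.2
      have h2 := hrmin q ⟨hq, hpq⟩
      have h3 := h.lt_iff r hr.1 q hq
      have h4 := h.lt_iff q hq r hr.1
      rw [show q = r from Prod.ext (by omega) (by omega)]
      exact hv
    · have h1 := hlmax p ⟨hp, hpq⟩
      have h2 : l.1 ≤ p.1 := by
        by_contra h2
        have := hgap' l hl.1 (by omega)
        simp only at this
        omega
      have h3 := h.lt_iff l hl.1 p hp
      have h4 := h.lt_iff p hp l hl.1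
      rw [show p = l from Prod.ext (by omega) (by omega)]
      exact hu
    · exact hmono.gap p hp q hq hpq hgap'

theorem exists_eq_var {n : ℕ} (t : (wordLang A).Term (Empty ⊕ Fin n)) :
    ∃ j, t = Term.var (Sum.inr j) := by
  cases t with
  | var v =>
    cases v with
    | inl e => exact e.elim
    | inr j => exact ⟨j, rfl⟩
  | func f _ => exact f.elim

theorem MatchedMarks.sat_iff_of_isQF {i k n : ℕ} {w w' : FreeMonoid A} {S : Finset (ℕ × ℕ)}
    (h : MatchedMarks i k w w' S) {φ : (wordLang A).BoundedFormula Empty n} (hφ : φ.IsQF)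
    {xs : Fin n → Fin w.toList.length} {ys : Fin n → Fin w'.toList.length}
    (hS : ∀ j, ((xs j : ℕ) + 1, (ys j : ℕ) + 1) ∈ S) : Sat w φ xs ↔ Sat w' φ ys := by
  induction hφ with
  | falsum => exact Iff.rfl
  | of_isAtomic ha =>
    cases ha with
    | equal t₁ t₂ =>
      obtain ⟨j₁, rfl⟩ := exists_eq_var t₁
      obtain ⟨j₂, rfl⟩ := exists_eq_var t₂
      have h1 := h.lt_iff _ (hS j₁) _ (hS j₂)
      have h2 := h.lt_iff _ (hS j₂) _ (hS j₁)
      change xs j₁ = xs j₂ ↔ ys j₁ = ys j₂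
      simp only at h1 h2
      rw [Fin.ext_iff, Fin.ext_iff]
      omega
    | @rel l R ts =>
      cases R with
      | lt =>
        obtain ⟨j₁, h₁⟩ := exists_eq_var (ts 0)
        obtain ⟨j₂, h₂⟩ := exists_eq_var (ts 1)
        obtain rfl : ts = ![Term.var (Sum.inr j₁), Term.var (Sum.inr j₂)] := by
          funext l; fin_cases l <;> assumption
        have h1 := h.lt_iff _ (hS j₁) _ (hS j₂)
        change xs j₁ < xs j₂ ↔ ys j₁ < ys j₂
        simp only at h1
        rw [Fin.lt_def, Fin.lt_def]
        omega
      | letter a =>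
        obtain ⟨j, hj⟩ := exists_eq_var (ts 0)
        obtain rfl : ts = ![Term.var (Sum.inr j)] := by
          funext l; fin_cases l; assumption
        change w.toList.get (xs j) = a ↔ w'.toList.get (ys j) = a
        have h1 := h.letter _ (hS j) (by simp)
        simp only [Nat.add_sub_cancel, Fin.is_lt, getElem?_pos,
          Option.some.injEq] at h1
        simp only [List.get_eq_getElem, h1]
  | imp _ _ ih₁ ih₂ => exact imp_congr ih₁ ih₂

theorem sat_all {n : ℕ} {w : FreeMonoid A} {φ : (wordLang A).BoundedFormula Empty (n + 1)}
    {xs : Fin n → Fin w.toList.length} : Sat w φ.all xs ↔ ∀ x, Sat w φ (Fin.snoc xs x) :=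
  Iff.rfl

theorem sat_ex {n : ℕ} {w : FreeMonoid A} {φ : (wordLang A).BoundedFormula Empty (n + 1)}
    {xs : Fin n → Fin w.toList.length} : Sat w φ.ex xs ↔ ∃ x, Sat w φ (Fin.snoc xs x) :=
  @BoundedFormula.realize_ex _ _ (wordStructure w.toList) _ _ _ _ _

/-- `Σ_i` formulas of rank at most `k` go from `w` to `w'`, and `Π_i` formulas from `w'` to `w`. Both
halves are needed at once, as the premise of an implication changes sides. -/
theorem MatchedMarks.sat {b : Bool} {i n : ℕ} {φ : (wordLang A).BoundedFormula Empty n}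
    (hφ : InLevel b i φ) {k : ℕ} {w w' : FreeMonoid A} {S : Finset (ℕ × ℕ)}
    {xs : Fin n → Fin w.toList.length} {ys : Fin n → Fin w'.toList.length}
    (hk : quantRank φ ≤ k) (h : MatchedMarks i k w w' S)
    (hS : ∀ j, ((xs j : ℕ) + 1, (ys j : ℕ) + 1) ∈ S) :
    (b = true → Sat w φ xs → Sat w' φ ys) ∧ (b = false → Sat w' φ ys → Sat w φ xs) := by
  induction hφ generalizing k w w' S with
  | of_isQF hφ => exact ⟨fun _ => (h.sat_iff_of_isQF hφ hS).1, fun _ => (h.sat_iff_of_isQF hφ hS).2⟩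
  | imp _ _ ih₁ ih₂ =>
    have hk' := max_le_iff.1 hk
    have h₁ := ih₁ hk'.1 h hS
    have h₂ := ih₂ hk'.2 h hS
    exact ⟨fun hb hs hs' => h₂.1 hb (hs (h₁.2 (by simp [hb]) hs')),
      fun hb hs hs' => h₂.2 hb (hs (h₁.1 (by simp [hb]) hs'))⟩
  | ex _ ih =>
    -- `φ.ex` is `¬ ∀ ¬ φ`, whence the shape of its rank.
    refine ⟨fun _ hs => ?_, by simp⟩
    rw [sat_ex] at hs ⊢
    obtain ⟨x, hx⟩ := hs
    change max (max (quantRank _) 0 + 1) 0 ≤ k at hk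
    obtain ⟨k, rfl⟩ : ∃ k', k = k' + 1 := ⟨k - 1, by omega⟩
    obtain ⟨y, S', hSS', hxy, h'⟩ := h.extend x
    refine ⟨y, (ih (by omega) h' fun j => ?_).1 rfl hx⟩
    induction j using Fin.lastCases with
    | last => simpa using hxy
    | cast j => simpa using hSS' (hS j)
  | all _ ih =>
    refine ⟨by simp, fun _ hs => ?_⟩
    rw [sat_all] at hs ⊢
    intro x
    change quantRank _ + 1 ≤ k at hk
    obtain ⟨k, rfl⟩ : ∃ k', k = k' + 1 := ⟨k - 1, by omega⟩
    obtain ⟨y, S', hSS', hxy, h'⟩ := h.extend x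
    refine (ih (by omega) h' fun j => ?_).2 rfl (hs y)
    induction j using Fin.lastCases with
    | last => simpa using hxy
    | cast j => simpa using hSS' (hS j)
  | next _ ih =>
    have h₁ := ih hk h.swap (xs := ys) (ys := xs) fun j =>
      Finset.mem_image.2 ⟨_, hS j, rfl⟩
    exact ⟨fun hb => h₁.2 (by simp [hb]), fun hb => h₁.1 (by simp [hb])⟩

theorem GameLE.sigmaLE {i k : ℕ} {w w' : FreeMonoid A} (h : GameLE i k w w') :
    SigmaLE i k w w' := by
  intro φ hφ hk hw
  have hm : MatchedMarks i k w w' {(0, 0), (w.toList.length + 1, w'.toList.length + 1)} := by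
    constructor <;> simp [factor_zero_length, h]
  exact (hm.sat (xs := default) (ys := default) hφ hk (fun j => j.elim0)).1 rfl hw

end Soundness

/-! ### Upper sets of the game preorder are definable -/

section Definability
variable {A : Type*}
open FreeMonoid (of)
open FirstOrder Language

/-- `K` is definable by `Σ_i` (for `b = true`) or `Π_i` (for `b = false`) formulas relativized to the
factor strictly between two variables, where `none` stands for a missing bound on that side. If the
bounds are in the wrong order the factor is the empty word. -/
def FactorDefinable (b : Bool) (i : ℕ) (K : Set (FreeMonoid A)) : Prop :=
  ∀ (n : ℕ) (lo hi : Option (Fin n)), ∃ φ : (wordLang A).BoundedFormula Empty n,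
    InLevel b i φ ∧ ∀ (w : FreeMonoid A) (xs : Fin n → Fin w.toList.length),
      Sat w φ xs ↔ factor w (lo.elim 0 fun j => (xs j : ℕ) + 1)
        (hi.elim (w.toList.length + 1) fun j => (xs j : ℕ) + 1) ∈ K

theorem InLevel.not {b : Bool} {i n : ℕ} {φ : (wordLang A).BoundedFormula Empty n}
    (h : InLevel (!b) i φ) : InLevel b i φ.not :=
  h.imp (InLevel.of_isQF BoundedFormula.isQF_bot)

theorem InLevel.inf {b : Bool} {i n : ℕ} {φ ψ : (wordLang A).BoundedFormula Empty n}
    (h : InLevel b i φ) (h' : InLevel b i ψ) : InLevel b i (φ ⊓ ψ) := by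
  refine InLevel.not (InLevel.imp ?_ (InLevel.not ?_)) <;> simpa

theorem sat_inf {n : ℕ} {w : FreeMonoid A} {φ ψ : (wordLang A).BoundedFormula Empty n}
    {xs : Fin n → Fin w.toList.length} : Sat w (φ ⊓ ψ) xs ↔ Sat w φ xs ∧ Sat w ψ xs :=
  @BoundedFormula.realize_inf _ _ (wordStructure w.toList) _ _ _ _ _ _

theorem FactorDefinable.univ (b : Bool) (i : ℕ) :
    FactorDefinable b i (Set.univ : Set (FreeMonoid A)) := fun _ _ _ =>
  ⟨⊤, InLevel.of_isQF BoundedFormula.IsQF.top, fun w _ =>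
    iff_of_true (@BoundedFormula.realize_top _ _ (wordStructure w.toList) _ _ _ _ |>.2 trivial)
      trivial⟩

theorem FactorDefinable.compl {b : Bool} {i : ℕ} {K : Set (FreeMonoid A)}
    (h : FactorDefinable (!b) i K) : FactorDefinable b i Kᶜ := by
  intro n lo hi
  obtain ⟨φ, hφ, hs⟩ := h n lo hi
  exact ⟨φ.not, hφ.not, fun w xs => not_congr (hs w xs)⟩

/-- Passing to the next level, with the opposite first quantifier. -/
theorem FactorDefinable.next {b : Bool} {i : ℕ} {K : Set (FreeMonoid A)}
    (h : FactorDefinable (!b) i K) : FactorDefinable b (i + 1) K := by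
  intro n lo hi
  obtain ⟨φ, hφ, hs⟩ := h n lo hi
  exact ⟨φ, hφ.next, hs⟩

theorem FactorDefinable.inter {b : Bool} {i : ℕ} {K K' : Set (FreeMonoid A)}
    (h : FactorDefinable b i K) (h' : FactorDefinable b i K') :
    FactorDefinable b i (K ∩ K') := by
  intro n lo hi
  obtain ⟨φ, hφ, hs⟩ := h n lo hi
  obtain ⟨ψ, hψ, hs'⟩ := h' n lo hi
  exact ⟨φ ⊓ ψ, hφ.inf hψ, fun w xs => sat_inf.trans (and_congr (hs w xs) (hs' w xs))⟩

theorem FactorDefinable.sInter {b : Bool} {i : ℕ} {F : Set (Set (FreeMonoid A))}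
    (hF : F.Finite) (h : ∀ K ∈ F, FactorDefinable b i K) : FactorDefinable b i (⋂₀ F) := by
  induction F, hF using Set.Finite.induction_on with
  | empty => simpa using FactorDefinable.univ b i
  | insert _ _ ih =>
    rw [Set.sInter_insert]
    exact (h _ (Set.mem_insert _ _)).inter (ih fun K hK => h K (Set.mem_insert_of_mem _ hK))

theorem FactorDefinable.sUnion {b : Bool} {i : ℕ} {F : Set (Set (FreeMonoid A))}
    (hF : F.Finite) (h : ∀ K ∈ F, FactorDefinable b i K) : FactorDefinable b i (⋃₀ F) := by
  rw [Set.sUnion_eq_compl_sInter_compl]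
  refine (FactorDefinable.sInter (hF.image _) ?_).compl
  rintro _ ⟨K, hK, rfl⟩
  exact FactorDefinable.compl (by simpa using h K hK)

/-- The marked product `K a K'`. -/
def markedMul (K : Set (FreeMonoid A)) (a : A) (K' : Set (FreeMonoid A)) : Set (FreeMonoid A) :=
  {w | ∃ u ∈ K, ∃ v ∈ K', w = u * of a * v}

theorem factor_mem_markedMul {K K' : Set (FreeMonoid A)} {a : A} {w : FreeMonoid A} {p q : ℕ}
    (hq : q ≤ w.toList.length + 1) :
    factor w p q ∈ markedMul K a K' ↔ ∃ x : Fin w.toList.length, p < (x : ℕ) + 1 ∧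
      (x : ℕ) + 1 < q ∧ w.toList.get x = a ∧ factor w p (x + 1) ∈ K ∧ factor w (x + 1) q ∈ K' := by
  constructor
  · rintro ⟨u, hu, v, hv, h⟩
    obtain ⟨x, hpx, hxq, ha, rfl, rfl⟩ := factor_eq_mul hq h
    have hx : x - 1 + 1 = x := by omega
    refine ⟨⟨x - 1, by omega⟩, ?_⟩
    simp only [hx, List.get_eq_getElem]
    exact ⟨hpx, hxq, (List.getElem?_eq_some_iff.1 ha).2, hu, hv⟩
  · rintro ⟨x, hpx, hxq, ha, hu, hv⟩
    exact ⟨_, hu, _, hv, factor_eq_factor_mul hpx hxq hq (by simpa using ha)⟩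

theorem exists_qf_lt {n : ℕ} (s t : Fin n) : ∃ φ : (wordLang A).BoundedFormula Empty n,
    φ.IsQF ∧ ∀ (w : FreeMonoid A) (xs : Fin n → Fin w.toList.length),
      Sat w φ xs ↔ xs s < xs t :=
  ⟨BoundedFormula.rel (L := wordLang A) (l := 2) WordRel.lt
    ![Term.var (Sum.inr s), Term.var (Sum.inr t)], (BoundedFormula.IsAtomic.rel _ _).isQF,
    fun _ _ => Iff.rfl⟩

theorem exists_qf_letter {n : ℕ} (a : A) (s : Fin n) :
    ∃ φ : (wordLang A).BoundedFormula Empty n,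
      φ.IsQF ∧ ∀ (w : FreeMonoid A) (xs : Fin n → Fin w.toList.length),
        Sat w φ xs ↔ w.toList.get (xs s) = a :=
  ⟨BoundedFormula.rel (L := wordLang A) (l := 1) (WordRel.letter a)
    ![Term.var (Sum.inr s)], (BoundedFormula.IsAtomic.rel _ _).isQF,
    fun _ _ => Iff.rfl⟩

/-- The letter `a` is guessed by an existential quantifier; the new variable bounds both factors. -/
theorem FactorDefinable.markedMul {i : ℕ} {K K' : Set (FreeMonoid A)}
    (h : FactorDefinable true (i + 1) K) (a : A) (h' : FactorDefinable true (i + 1) K') :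
    FactorDefinable true (i + 1) (markedMul K a K') := by
  intro n lo hi
  obtain ⟨φ, hφ, hs⟩ := h (n + 1) (lo.map Fin.castSucc) (some (Fin.last n))
  obtain ⟨ψ, hψ, hs'⟩ := h' (n + 1) (some (Fin.last n)) (hi.map Fin.castSucc)
  obtain ⟨χ, hχ, hsa⟩ := exists_qf_letter a (Fin.last n)
  obtain ⟨φlo, hlo, hslo⟩ : ∃ θ : (wordLang A).BoundedFormula Empty (n + 1), θ.IsQF ∧
      ∀ (w : FreeMonoid A) (xs : Fin n → Fin w.toList.length) (x : Fin w.toList.length),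
        Sat w θ (Fin.snoc xs x) ↔ (lo.elim 0 fun j => (xs j : ℕ) + 1) < (x : ℕ) + 1 := by
    cases lo with
    | none =>
      exact ⟨⊤, BoundedFormula.IsQF.top, fun w xs x => iff_of_true
        (@BoundedFormula.realize_top _ _ (wordStructure w.toList) _ _ _ _ |>.2 trivial)
        (by simp)⟩
    | some j =>
      obtain ⟨θ, hθ, hst⟩ := exists_qf_lt (A := A) j.castSucc (Fin.last n)
      exact ⟨θ, hθ, fun w xs x => by simp [hst]⟩
  obtain ⟨φhi, hhi, hshi⟩ : ∃ θ : (wordLang A).BoundedFormula Empty (n + 1), θ.IsQF ∧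
      ∀ (w : FreeMonoid A) (xs : Fin n → Fin w.toList.length) (x : Fin w.toList.length),
        Sat w θ (Fin.snoc xs x) ↔
          (x : ℕ) + 1 < hi.elim (w.toList.length + 1) fun j => (xs j : ℕ) + 1 := by
    cases hi with
    | none =>
      exact ⟨⊤, BoundedFormula.IsQF.top, fun w xs x => iff_of_true
        (@BoundedFormula.realize_top _ _ (wordStructure w.toList) _ _ _ _ |>.2 trivial)
        (by simp)⟩
    | some j =>
      obtain ⟨θ, hθ, hst⟩ := exists_qf_lt (A := A) (Fin.last n) j.castSucc
      exact ⟨θ, hθ, fun w xs x => by simp [hst]⟩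
  refine ⟨(φlo ⊓ (φhi ⊓ (χ ⊓ (φ ⊓ ψ)))).ex, InLevel.ex ((InLevel.of_isQF hlo).inf
    ((InLevel.of_isQF hhi).inf ((InLevel.of_isQF hχ).inf (hφ.inf hψ)))), fun w xs => ?_⟩
  rw [sat_ex, factor_mem_markedMul]
  · refine exists_congr fun x => ?_
    rw [sat_inf, sat_inf, sat_inf, sat_inf, hslo, hshi, hsa, hs, hs']
    cases lo <;> cases hi <;> simp
  · cases hi with
    | none => simp
    | some j => exact Nat.succ_le_succ (xs j).isLt.le

/-- The words above `w` in the game preorder. -/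
def gameUpper (i k : ℕ) (w : FreeMonoid A) : Set (FreeMonoid A) := {w' | GameLE i k w w'}

/-- For every way to split `w` at a position, the set of words with a position answering it. -/
def splitProducts (i k : ℕ) (w : FreeMonoid A) : Set (Set (FreeMonoid A)) :=
  {C | ∃ u a v, w = u * of a * v ∧ C = markedMul (gameUpper i k u) a (gameUpper i k v)}

/-- A lower set is the complement of a union of upper sets: if `¬ w' ≤ w`, then the upper set of
`w'` contains `w'` and misses `w`. -/
theorem gameLower_eq_compl (i k : ℕ) (w : FreeMonoid A) :
    {w' | GameLE i k w' w} = (⋃₀ {U ∈ Set.range (gameUpper (A := A) i k) | w ∉ U})ᶜ := by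
  ext w'
  simp only [Set.mem_ofPred_eq, Set.mem_compl_iff, Set.mem_sUnion, not_exists, not_and]
  constructor
  · rintro h _ ⟨⟨v, rfl⟩, hv⟩ hv'
    exact hv (GameLE.trans hv' h)
  · intro h
    by_contra hn
    exact h _ ⟨⟨w', rfl⟩, hn⟩ (GameLE.refl _ _ _)

theorem gameUpper_succ_succ (i k : ℕ) (w : FreeMonoid A) :
    gameUpper (i + 1) (k + 1) w = {w' | GameLE i (k + 1) w' w} ∩
      ⋂₀ splitProducts (i + 1) k w := by
  ext w'
  simp only [gameUpper, splitProducts, Set.mem_ofPred_eq, gameLE_succ_succ, Set.mem_inter_iff,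
    Set.mem_sInter]
  refine and_congr Iff.rfl ⟨?_, ?_⟩
  · rintro h _ ⟨u, a, v, hw, rfl⟩
    obtain ⟨u', v', hw', hu, hv⟩ := h u a v hw
    exact ⟨u', hu, v', hv, hw'⟩
  · intro h u a v hw
    obtain ⟨u', hu, v', hv, hw'⟩ := h _ ⟨u, a, v, hw, rfl⟩
    exact ⟨u', v', hw', hu, hv⟩

/-- Over a finite alphabet, the game preorder has finitely many upper sets generated by one word,
each of them `Σ_i`-definable. Finiteness has to be carried through the induction, because it makes
the unions and intersections expressible. -/
theorem finite_range_gameUpper_and_factorDefinable [Finite A] (i k : ℕ) :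
    (Set.range (gameUpper (A := A) i k)).Finite ∧
      ∀ w : FreeMonoid A, FactorDefinable true i (gameUpper i k w) := by
  induction i generalizing k with
  | zero =>
    have h : gameUpper (A := A) 0 k = fun _ => Set.univ := by
      ext w w'; simp [gameUpper, gameLE_zero_left]
    rw [h]
    exact ⟨Set.finite_range_const, fun _ => FactorDefinable.univ _ _⟩
  | succ i ihi =>
    induction k with
    | zero =>
      have h : gameUpper (A := A) (i + 1) 0 = fun _ => Set.univ := by
        ext w w'; simp [gameUpper, gameLE_zero_right]
      rw [h]
      exact ⟨Set.finite_range_const, fun _ => FactorDefinable.univ _ _⟩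
    | succ k ihk =>
      obtain ⟨hfin₁, hdef₁⟩ := ihi (k + 1)
      obtain ⟨hfin₂, hdef₂⟩ := ihk
      have hfinC : (Set.range fun x : FreeMonoid A × A × FreeMonoid A =>
          markedMul (gameUpper (i + 1) k x.1) x.2.1 (gameUpper (i + 1) k x.2.2)).Finite := by
        refine ((hfin₂.prod (Set.finite_univ.prod hfin₂)).image
          fun y => markedMul y.1 y.2.1 y.2.2).subset ?_
        rintro _ ⟨x, rfl⟩
        exact ⟨(gameUpper (i + 1) k x.1, x.2.1, gameUpper (i + 1) k x.2.2),
          ⟨⟨_, rfl⟩, Set.mem_univ _, ⟨_, rfl⟩⟩, rfl⟩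
      have hsub : ∀ w : FreeMonoid A, splitProducts (i + 1) k w ⊆
          Set.range fun x : FreeMonoid A × A × FreeMonoid A =>
            markedMul (gameUpper (i + 1) k x.1) x.2.1 (gameUpper (i + 1) k x.2.2) := by
        rintro w _ ⟨u, a, v, -, rfl⟩
        exact ⟨(u, a, v), rfl⟩
      constructor
      · refine ((hfin₁.finite_subsets.prod hfinC.finite_subsets).image
          fun y : Set (Set (FreeMonoid A)) × Set (Set (FreeMonoid A)) => (⋃₀ y.1)ᶜ ∩ ⋂₀ y.2).subset ?_
        rintro _ ⟨w, rfl⟩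
        exact ⟨({U ∈ Set.range (gameUpper (A := A) i (k + 1)) | w ∉ U}, splitProducts (i + 1) k w),
          ⟨Set.sep_subset _ _, hsub w⟩,
          by rw [gameUpper_succ_succ, gameLower_eq_compl]⟩
      · intro w
        rw [gameUpper_succ_succ, gameLower_eq_compl]
        refine (FactorDefinable.next (FactorDefinable.compl (FactorDefinable.sUnion
          (hfin₁.subset (Set.sep_subset _ _)) ?_))).inter
            (FactorDefinable.sInter (hfinC.subset (hsub w)) ?_)
        · rintro _ ⟨⟨v, rfl⟩, -⟩
          exact hdef₁ v
        · rintro _ ⟨u, a, v, -, rfl⟩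
          exact (hdef₂ u).markedMul a (hdef₂ v)

theorem FactorDefinable.exists_sentence {i : ℕ} {K : Set (FreeMonoid A)}
    (h : FactorDefinable true i K) :
    ∃ φ : (wordLang A).Sentence, IsSigma i φ ∧ ∀ w, Models w φ ↔ w ∈ K := by
  obtain ⟨φ, hφ, hs⟩ := h 0 none none
  refine ⟨φ, hφ, fun w => ?_⟩
  have := hs w default
  simp only [Option.elim_none, factor_zero_length] at this
  exact this

/-- Every rank of the game is controlled by some, possibly larger, quantifier rank: that of the
finitely many sentences defining the sets `gameUpper i k w`. -/
theorem exists_sigmaLE_imp_gameLE [Finite A] (i k : ℕ) :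
    ∃ k', ∀ w w' : FreeMonoid A, SigmaLE i k' w w' → GameLE i k w w' := by
  obtain ⟨hfin, hdef⟩ := finite_range_gameUpper_and_factorDefinable (A := A) i k
  have h : ∀ U : Set (FreeMonoid A), ∃ φ : (wordLang A).Sentence,
      U ∈ Set.range (gameUpper (A := A) i k) → IsSigma i φ ∧ ∀ w, Models w φ ↔ w ∈ U := by
    intro U
    by_cases hU : U ∈ Set.range (gameUpper (A := A) i k)
    · obtain ⟨w, rfl⟩ := hU
      obtain ⟨φ, hφ⟩ := (hdef w).exists_sentence
      exact ⟨φ, fun _ => hφ⟩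
    · exact ⟨⊥, fun h => absurd h hU⟩
  choose φ hφ using h
  obtain ⟨k', hk'⟩ := (hfin.image fun U => quantRank (φ U)).bddAbove
  refine ⟨k', fun w w' hw => ?_⟩
  have hw₁ := hφ (gameUpper i k w) ⟨w, rfl⟩
  exact (hw₁.2 w').1 (hw _ hw₁.1 (hk' ⟨_, ⟨w, rfl⟩, rfl⟩)
    ((hw₁.2 w).2 (GameLE.refl _ _ _)))

end Definability

/-! ### Chains and the characterization -/

section Characterization
variable {A : Type*}

theorem SigmaLE.mono {i k k' : ℕ} {w w' : FreeMonoid A} (h : SigmaLE i k' w w') (hk : k ≤ k') :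
    SigmaLE i k w w' := fun φ hφ hr => h φ hφ (hr.trans hk)

theorem exists_gameLE_of_mem_sigmaChains [Finite A] {M : Type*} [Monoid M]
    {α : FreeMonoid A →* M} (hα : Function.Surjective α) {j : ℕ} {t s : M}
    (h : [t, s] ∈ sigmaChains α j) (k : ℕ) :
    ∃ w₁ w₂, α w₁ = t ∧ α w₂ = s ∧ GameLE j k w₁ w₂ := by
  cases j with
  | zero =>
    obtain ⟨w₁, rfl⟩ := hα t
    obtain ⟨w₂, rfl⟩ := hα s
    exact ⟨w₁, w₂, rfl, rfl, gameLE_zero_left _ _ _⟩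
  | succ j =>
    obtain ⟨k', hk'⟩ := exists_sigmaLE_imp_gameLE (A := A) (j + 1) k
    obtain ⟨ws, hws, hmap⟩ := Set.mem_iInter.1 h k'
    match ws, hws, hmap with
    | [w₁, w₂], hws, hmap =>
      simp only [List.map_cons, List.map_nil, List.cons.injEq, and_true] at hmap
      exact ⟨w₁, w₂, hmap.1, hmap.2, hk' _ _ (by simpa using hws)⟩

/-- Since `M × M` is finite, a single rank detects all pairs that are not chains. -/
theorem exists_gameLE_imp_mem_sigmaChains {M : Type*} [Monoid M] [Finite M]
    (α : FreeMonoid A →* M) (j : ℕ) :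
    ∃ K, ∀ w₁ w₂, GameLE j K w₁ w₂ → [α w₁, α w₂] ∈ sigmaChains α j := by
  cases j with
  | zero => exact ⟨0, fun _ _ _ => Set.mem_iInter.2 fun _ => Set.mem_univ _⟩
  | succ j =>
    have h : ∀ x : M × M, ∃ k, [x.1, x.2] ∈ sigmaKChains α (j + 1) k →
        [x.1, x.2] ∈ sigmaChains α (j + 1) := by
      intro x
      by_contra! hx
      exact (hx 0).2 (Set.mem_iInter.2 fun k => (hx k).1)
    choose k hk using h
    obtain ⟨K, hK⟩ := (Set.finite_range k).bddAbove
    exact ⟨K, fun w₁ w₂ hw => hk (α w₁, α w₂)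
      ⟨[w₁, w₂], by simpa using hw.sigmaLE.mono (hK ⟨_, rfl⟩), by simp⟩⟩

theorem SigmaDefinable.pow_omega_le [Finite A] {L : Language A} [Finite (SyntacticMonoid L)]
    {j : ℕ} (h : SigmaDefinable (j + 1) L) {t s : SyntacticMonoid L}
    (hts : [t, s] ∈ sigmaChains (syntacticMorphism L) j) :
    s ^ omega (SyntacticMonoid L) ≤
      s ^ omega (SyntacticMonoid L) * t * s ^ omega (SyntacticMonoid L) := by
  obtain ⟨φ, hφ, hL⟩ := h
  obtain ⟨k, hk⟩ : ∃ k, k = quantRank φ := ⟨_, rfl⟩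
  -- Choose words for the chain; a large power of `w₂` has the image `s ^ ω`.
  obtain ⟨w₁, w₂, rfl, rfl, hw⟩ :=
    exists_gameLE_of_mem_sigmaChains (syntacticMorphism_surjective L) hts k
  obtain ⟨hω, hidem⟩ := omega_spec (SyntacticMonoid L)
  have hpow : syntacticMorphism L w₂ ^ omega (SyntacticMonoid L) =
      syntacticMorphism L (w₂ ^ (omega (SyntacticMonoid L) * 2 ^ k)) := by
    obtain ⟨m, hm⟩ := Nat.exists_eq_succ_of_ne_zero (pow_ne_zero k (two_ne_zero (α := ℕ)))
    rw [map_pow, pow_mul, hm, (hidem _).pow_succ_eq]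
  have hle : 2 ^ k ≤ omega (SyntacticMonoid L) * 2 ^ k + 1 :=
    (Nat.le_mul_of_pos_left _ hω).trans (Nat.le_succ _)
  rw [hpow, ← map_mul, ← map_mul, syntacticMorphism_le_iff]
  intro x y hxy
  rw [hL] at hxy ⊢
  have hgame := hw.pow_pow_mul_pow hle hle hle
  exact (((GameLE.refl _ _ x).mul hgame).mul (GameLE.refl _ _ y)).sigmaLE φ hφ hk.ge hxy

/-- Under the chain condition, a rank linear in the height of a forest suffices for the game preorder
to refine the syntactic preorder. At an idempotent node `u z v` of image `e`, the answer splits as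
`u' z' v'`; exchanging the two words, `z'` is below `z` one level lower, so `(α z', e)` is a chain
and `e ≤ e * α z' * e ≤ α u' * α z' * α v'`. -/
theorem HasForest.le_of_gameLE {L : Language A} [Finite (SyntacticMonoid L)] {j K : ℕ}
    (hK : ∀ w₁ w₂, GameLE j K w₁ w₂ →
      [syntacticMorphism L w₁, syntacticMorphism L w₂] ∈ sigmaChains (syntacticMorphism L) j)
    (hchain : ∀ t s : SyntacticMonoid L, [t, s] ∈ sigmaChains (syntacticMorphism L) j →
      s ^ omega (SyntacticMonoid L) ≤
        s ^ omega (SyntacticMonoid L) * t * s ^ omega (SyntacticMonoid L))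
    {h : ℕ} {w w' : FreeMonoid A} (hw : HasForest (syntacticMorphism L) h w)
    (hww' : GameLE (j + 1) (K + 1 + 2 * h) w w') :
    syntacticMorphism L w ≤ syntacticMorphism L w' := by
  -- The pair `(α w', 1)` is a chain.
  have hone : ∀ {w' : FreeMonoid A}, GameLE (j + 1) K 1 w' → 1 ≤ syntacticMorphism L w' := by
    intro w' hw'
    have := hchain _ _ (hK _ _ hw'.swap)
    simpa using this
  induction hw generalizing w' with
  | one => rw [map_one]; exact hone (hww'.mono (by omega))
  | of a =>
    obtain ⟨u', v', rfl, hu, hv⟩ := (gameLE_succ_succ.1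
      (hww'.mono (k := K + 1) (by omega))).2 1 a 1 (by simp)
    rw [map_mul, map_mul]
    simpa using SyntacticMonoid.mul_le_mul (SyntacticMonoid.mul_le_mul (hone hu)
      (le_refl (syntacticMorphism L (FreeMonoid.of a)))) (hone hv)
  | @mul h u v _ _ ihu ihv =>
    obtain ⟨u', v', rfl, hu, hv⟩ := (hww'.mono (k := K + 1 + 2 * h + 1) (by omega)).exists_mul
    rw [map_mul, map_mul]
    exact SyntacticMonoid.mul_le_mul (ihu hu) (ihv hv)
  | @idem h u z v e he _ _ hu hz hv ihu ihv =>
    obtain ⟨x', v', rfl, hx', hv'⟩ :=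
      (hww'.mono (k := K + 1 + 2 * h + 1 + 1) (by omega)).exists_mul
    obtain ⟨u', z', rfl, hu', hz'⟩ := hx'.exists_mul
    have h1 := ihu hu'
    have h2 := ihv hv'.of_succ
    have h3 := hchain _ _ (hK _ _ (hz'.mono (k := K) (by omega)).swap)
    obtain ⟨m, hm⟩ := Nat.exists_eq_succ_of_ne_zero (omega_spec (SyntacticMonoid L)).1.ne'
    rw [hz, hm, he.pow_succ_eq] at h3
    rw [hu] at h1
    rw [hv] at h2
    rw [map_mul, map_mul, map_mul, map_mul, hu, hz, hv, he.eq, he.eq]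
    exact h3.trans (SyntacticMonoid.mul_le_mul (SyntacticMonoid.mul_le_mul h1 le_rfl) h2)

theorem sigmaDefinable_of_pow_omega_le [Finite A] {L : Language A} [Finite (SyntacticMonoid L)]
    {j : ℕ} (hchain : ∀ t s : SyntacticMonoid L, [t, s] ∈ sigmaChains (syntacticMorphism L) j →
      s ^ omega (SyntacticMonoid L) ≤
        s ^ omega (SyntacticMonoid L) * t * s ^ omega (SyntacticMonoid L)) :
    SigmaDefinable (j + 1) L := by
  obtain ⟨h, hforest⟩ := exists_forall_hasForest (syntacticMorphism L)
  obtain ⟨K, hK⟩ := exists_gameLE_imp_mem_sigmaChains (syntacticMorphism L) j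
  obtain ⟨hfin, hdef⟩ :=
    finite_range_gameUpper_and_factorDefinable (A := A) (j + 1) (K + 1 + 2 * h)
  have hunion : FactorDefinable true (j + 1)
      (⋃₀ (gameUpper (j + 1) (K + 1 + 2 * h) '' {w : FreeMonoid A | w.toList ∈ L})) := by
    refine FactorDefinable.sUnion (hfin.subset (Set.image_subset_range _ _)) ?_
    rintro _ ⟨w, -, rfl⟩
    exact hdef w
  obtain ⟨φ, hφ, hs⟩ := hunion.exists_sentence
  refine ⟨φ, hφ, fun w => ?_⟩
  rw [hs]
  constructor
  · exact fun hw => ⟨_, ⟨w, hw, rfl⟩, GameLE.refl _ _ _⟩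
  · rintro ⟨_, ⟨v, hv, rfl⟩, hvw⟩
    have := (hforest v).le_of_gameLE hK hchain hvw
    rw [syntacticMorphism_le_iff] at this
    simpa using this 1 1 (by simpa using hv)

end Characterization

end QAlt

theorem theorem3 {A : Type*} [Finite A] (L : Language A) (hL : L.IsRegular)
    (i : ℕ) (hi : 1 ≤ i) :
    QAlt.SigmaDefinable i L ↔
      ∀ t s : QAlt.SyntacticMonoid L,
        [t, s] ∈ QAlt.sigmaChains (QAlt.syntacticMorphism L) (i - 1) →
          s ^ QAlt.omega (QAlt.SyntacticMonoid L) ≤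
            s ^ QAlt.omega (QAlt.SyntacticMonoid L) * t *
              s ^ QAlt.omega (QAlt.SyntacticMonoid L) := by
  have := QAlt.finite_syntacticMonoid hL
  obtain ⟨j, rfl⟩ := Nat.exists_eq_add_of_le' hi
  exact ⟨fun h _ _ => h.pow_omega_le, QAlt.sigmaDefinable_of_pow_omega_le⟩
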